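/- A free product $A*B$ of two nontrivial groups $A$ and $B$ is called strict if it is not isomorphic to $\mathbb{Z}_2*\mathbb{Z}_2$. A group $G$ is called a locally strict free product if any finitely many elements of $G$ are contained in a subgroup of $G$ which is isomorphic to a strict free product. A ring is called primitive if it has a faithful irreducible right module. Let $G$ be a locally strict free product, and suppose that $G$ has a free subgroup whose cardinality is the same as that of $G$. If $R$ is a domain (a nonzero ring with $1$, not necessarily commutative, without zero divisors) with $|R|\le |G|$, then the group ring $RG$ is primitive. Moreover, the group algebra $KG$ is primitive for every field $K$. -/

import Mathlib

universe u v w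

/-- A ring `S` is (right) primitive if it has a faithful irreducible right module. Right
`S`-modules are modules over the opposite ring `Sᵐᵒᵖ`. A simple module is a quotient of the ring
by a maximal one-sided ideal, so it is no restriction to take `M` in the universe of `S`. -/
def IsRightPrimitive (S : Type u) [Ring S] : Prop :=
  ∃ (M : Type u) (_ : AddCommGroup M) (_ : Module Sᵐᵒᵖ M),
    IsSimpleModule Sᵐᵒᵖ M ∧ FaithfulSMul Sᵐᵒᵖ M

/-- `N` is isomorphic to a strict free product, i.e. to a free product `A * B` of two nontrivial
groups which is not isomorphic to `ℤ₂ * ℤ₂`. The factors embed in `N`, so it is no restriction to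
take them in the universe of `N`. -/
def IsStrictFreeProduct (N : Type u) [Group N] : Prop :=
  ∃ (A B : Type u) (_ : Group A) (_ : Group B),
    Nontrivial A ∧ Nontrivial B ∧
    ¬ Nonempty (Monoid.Coprod A B ≃*
      Monoid.Coprod (Multiplicative (ZMod 2)) (Multiplicative (ZMod 2))) ∧
    Nonempty (N ≃* Monoid.Coprod A B)

/-- `G` is a locally strict free product: any finitely many elements of `G` lie in a subgroup
which is isomorphic to a strict free product. -/
def IsLocallyStrictFreeProduct (G : Type u) [Group G] : Prop :=
  ∀ s : Finset G, ∃ H : Subgroup G, (s : Set G) ⊆ (H : Set G) ∧ IsStrictFreeProduct H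

/-! Take a family of nonzero elements `δ i` of the group ring that meets every nonzero two-sided
ideal. To each `δ i` attach a generator: a group element plus a member of the two-sided ideal
generated by `δ i`. If these generators lie in a proper right ideal, extend it to a maximal one, m.
A nonzero annihilator of the quotient by m would contain some `δ i`; since it lies in m, subtraction
would put a group element, a unit, into m. So the quotient is simple and faithful
(`isRightPrimitive_of_alternatingFree`).

Properness is a count of supports. One factor of a strict free product has at least three elements,
and reduced words then provide translates and conjugates whose alternating products are nontrivial.
Hence the bipartite graphs recording coincidences between products of support elements are forests,
with no more edges than vertices (`card_le_of_no_closed_walk`). This limits cancellation both in `δ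
i * a * β` (`exists_card_support_le`) and between translates (`sum_card_support_le`), so that the
generators cannot combine to 1.

The method needs an alternating-free family as large as the `δ i`, and one of size |G| exists. If
|R| ≤ |G|, all nonzero elements of the group ring serve as the `δ i`. Over an arbitrary field, the
elements with coefficients in the countable prime field suffice (`exists_mapRingHom_mem`). -/

/-! ### Counting edges and clusters in finite graphs -/

open Finset in
lemma card_image_erase_lt {α β : Type*} [DecidableEq α] [DecidableEq β] (g : α → β)
    {E : Finset α} {e : α} (he : e ∈ E) (hg : ∀ f ∈ E, g f = g e → f = e) :
    #((E.erase e).image g) < #(E.image g) := by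
  refine card_lt_card ((ssubset_iff_of_subset (image_subset_image (erase_subset _ _))).2
    ⟨g e, mem_image_of_mem _ he, fun h ↦ ?_⟩)
  obtain ⟨f, hf, hfe⟩ := mem_image.1 h
  rw [mem_erase] at hf
  exact hf.1 (hg f hf.2 hfe)

open Finset in
/-- If every nonempty part of a finite bipartite multigraph has a leaf, then the graph is a forest,
so it has no more edges than vertices. -/
lemma card_le_card_image_add_card_image {α β γ : Type*} [DecidableEq α] [DecidableEq β]
    [DecidableEq γ] (l : α → β) (r : α → γ) (E : Finset α)
    (h : ∀ E' ⊆ E, E'.Nonempty → ∃ e ∈ E', (∀ f ∈ E', l f = l e → f = e) ∨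
      (∀ f ∈ E', r f = r e → f = e)) :
    #E ≤ #(E.image l) + #(E.image r) := by
  induction hn : #E generalizing E with
  | zero => exact Nat.zero_le _
  | succ n ih =>
    obtain ⟨e, he, hleaf⟩ := h E subset_rfl (card_pos.1 (by omega))
    have h1 := ih (E.erase e) (fun E' hE' ↦ h E' (hE'.trans (erase_subset _ _)))
      (by rw [card_erase_of_mem he, hn]; rfl)
    have hl : #((E.erase e).image l) ≤ #(E.image l) :=
      card_le_card (image_subset_image (erase_subset _ _))
    have hr : #((E.erase e).image r) ≤ #(E.image r) :=
      card_le_card (image_subset_image (erase_subset _ _))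
    rcases hleaf with hleaf | hleaf
    · have := card_image_erase_lt l he hleaf
      omega
    · have := card_image_erase_lt r he hleaf
      omega

open Finset in
/-- A finite bipartite multigraph without closed alternating walks has no more edges than
vertices. -/
lemma card_le_of_no_closed_walk {α β γ : Type*} [DecidableEq α] [DecidableEq β]
    [DecidableEq γ] (l : α → β) (r : α → γ) (E : Finset α)
    (h : ∀ e f : ℕ → α, (∀ n, e n ∈ E) → (∀ n, f n ∈ E) → (∀ n, l (f n) = l (e n)) →
      (∀ n, f n ≠ e n) → (∀ n, r (e (n + 1)) = r (f n)) → (∀ n, e (n + 1) ≠ f n) →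
      ∀ m, e (m + 1) ≠ e 0) :
    #E ≤ #(E.image l) + #(E.image r) := by
  refine card_le_card_image_add_card_image l r E fun E' hE' ⟨e₀, he₀⟩ ↦ ?_
  by_contra! hcon
  -- Without a leaf, every edge can be left at either end by a different edge. Alternating the ends
  -- gives an endless walk, which repeats by finiteness.
  choose! σ hσ using fun e he ↦ (hcon e he).1
  choose! τ hτ using fun e he ↦ (hcon e he).2
  let e : ℕ → α := fun n ↦ (fun x ↦ τ (σ x))^[n] e₀
  have hsucc : ∀ n, e (n + 1) = τ (σ (e n)) := fun n ↦ Function.iterate_succ_apply' _ _ _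
  have he : ∀ n, e n ∈ E' := by
    intro n
    induction n with
    | zero => exact he₀
    | succ n ih => rw [hsucc]; exact (hτ _ (hσ _ ih).1).1
  obtain ⟨i, j, hij, heq⟩ : ∃ i j, i < j ∧ e i = e j := by
    obtain ⟨i, j, hne, heq⟩ := Finite.exists_ne_map_eq_of_infinite
      (fun n : ℕ ↦ (⟨e n, he n⟩ : E'))
    have heq' : e i = e j := congrArg Subtype.val heq
    rcases lt_or_gt_of_ne hne with h | h
    · exact ⟨i, j, h, heq'⟩
    · exact ⟨j, i, h, heq'.symm⟩
  refine h (fun n ↦ e (i + n)) (fun n ↦ σ (e (i + n))) (fun n ↦ hE' (he _))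
    (fun n ↦ hE' (hσ _ (he _)).1) (fun n ↦ (hσ _ (he _)).2.1) (fun n ↦ (hσ _ (he _)).2.2)
    (fun n ↦ ?_) (fun n ↦ ?_) (j - i - 1) ?_
  · rw [← add_assoc, hsucc]
    exact (hτ _ (hσ _ (he _)).1).2.1
  · rw [← add_assoc, hsucc]
    exact (hτ _ (hσ _ (he _)).1).2.2
  · have : i + (j - i - 1 + 1) = j := by omega
    simp only [this, add_zero, heq]

open Finset in
/-- If all fibres of `f` on `s` have at least two elements, then `f` at least halves `s`. -/
lemma two_mul_card_image_le {α β : Type*} [DecidableEq β] (f : α → β) (s : Finset α)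
    (t : Finset β) (ht : t ⊆ s.image f)
    (h : ∀ a ∈ s, f a ∈ t → ∃ b ∈ s, b ≠ a ∧ f b = f a) : 2 * #t ≤ #s := by
  classical
  refine (mul_card_image_le_card_of_maps_to (s := s.filter fun a ↦ f a ∈ t) (f := f)
    (fun a ha ↦ (mem_filter.1 ha).2) 2 fun y hy ↦ ?_).trans (card_filter_le _ _)
  obtain ⟨a, ha, rfl⟩ := mem_image.1 (ht hy)
  obtain ⟨b, hb, hba, hfb⟩ := h a ha hy
  refine one_lt_card.2 ⟨a, ?_, b, ?_, hba.symm⟩ <;> simp_all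

open Finset in
/-- A finite graph without isolated vertices can be partitioned into clusters with at least two
vertices and of diameter at most four. -/
lemma exists_cluster {α : Type*} (N : Finset α) (rel : α → α → Prop)
    (hrefl : ∀ a ∈ N, rel a a) (hsymm : ∀ a b, rel a b → rel b a)
    (hN : ∀ a ∈ N, ∃ b ∈ N, b ≠ a ∧ rel a b) :
    ∃ c : α → α, (∀ a ∈ N, ∃ b ∈ N, b ≠ a ∧ c b = c a) ∧
      ∀ a ∈ N, c a ∈ N ∧ ∃ p ∈ N, rel a p ∧ rel p (c a) := by
  classical
  -- The centres form a maximal set in which no two have a common neighbour; maximality puts every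
  -- vertex within two steps of a centre.
  let good : Finset α → Prop := fun D ↦ ∀ d ∈ D, ∀ d' ∈ D, ∀ p ∈ N, rel p d → rel p d' → d = d'
  obtain ⟨D, hD, hmax⟩ := exists_max_image (N.powerset.filter good) card
    ⟨∅, by simp [good]⟩
  simp only [mem_filter, mem_powerset] at hD hmax
  obtain ⟨hDN, hgood⟩ := hD
  have hdom : ∀ a ∈ N, ∃ d ∈ D, ∃ p ∈ N, rel a p ∧ rel p d := by
    intro a ha
    by_contra! hcon
    have haD : a ∉ D := fun h ↦ hcon a h a ha (hrefl a ha) (hrefl a ha)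
    have := hmax (insert a D) ⟨insert_subset ha hDN, by
      intro d hd d' hd' p hp h1 h2
      rcases mem_insert.1 hd with hda | hd <;> rcases mem_insert.1 hd' with hda' | hd'
      · exact hda.trans hda'.symm
      · exact (hcon d' hd' p hp (hsymm _ _ (hda ▸ h1)) h2).elim
      · exact (hcon d hd p hp (hsymm _ _ (hda' ▸ h2)) h1).elim
      · exact hgood d hd d' hd' p hp h1 h2⟩
    rw [card_insert_of_notMem haD] at this
    omega
  -- A vertex adjacent to a centre is assigned to that unique centre, so each cluster contains the
  -- neighbours of its centre.
  have hc : ∀ a ∈ N, ∃ d ∈ D, (∃ p ∈ N, rel a p ∧ rel p d) ∧ ∀ d' ∈ D, rel a d' → d' = d := by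
    intro a ha
    by_cases h : ∃ d ∈ D, rel a d
    · obtain ⟨d, hd, had⟩ := h
      exact ⟨d, hd, ⟨a, ha, hrefl a ha, had⟩, fun d' hd' h ↦ hgood d' hd' d hd a ha h had⟩
    · push Not at h
      obtain ⟨d, hd, hp⟩ := hdom a ha
      exact ⟨d, hd, hp, fun d' hd' h' ↦ (h d' hd' h').elim⟩
  choose! c hcD hcp hcu using hc
  refine ⟨c, fun a ha ↦ ?_, fun a ha ↦ ⟨hDN (hcD a ha), hcp a ha⟩⟩
  have hd := hcD a ha
  obtain ⟨q, hq, hqd, hrel⟩ := hN _ (hDN hd)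
  have h1 : c (c a) = c a := (hcu _ (hDN hd) _ hd (hrefl _ (hDN hd))).symm
  have h2 : c q = c a := (hcu q hq _ hd (hsymm _ _ hrel)).symm
  by_cases h : a = c a
  · exact ⟨q, hq, fun h' ↦ hqd (h'.trans h), h2⟩
  · exact ⟨c a, hDN hd, fun h' ↦ h h'.symm, h1⟩

/-! ### Reduced words in free products -/

namespace Monoid.CoprodI

variable {ι : Type*} {M : ι → Type*} [∀ i, Group (M i)]

/-- The elements of a free product whose reduced word starts with a letter from the factor `i` and
ends with a letter from the factor `j`. -/
def ReducedFrom (M : ι → Type*) [∀ i, Group (M i)] (i j : ι) : Set (CoprodI M) :=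
  {g | ∃ w : NeWord M i j, w.prod = g}

variable {i j k l : ι} {g h : CoprodI M}

lemma of_mem_reducedFrom {x : M i} (hx : x ≠ 1) : of x ∈ ReducedFrom M i i :=
  ⟨.singleton x hx, NeWord.prod_singleton x hx⟩

lemma mul_mem_reducedFrom (hg : g ∈ ReducedFrom M i j) (hjk : j ≠ k)
    (hh : h ∈ ReducedFrom M k l) : g * h ∈ ReducedFrom M i l := by
  obtain ⟨w, rfl⟩ := hg
  obtain ⟨w', rfl⟩ := hh
  exact ⟨w.append hjk w', NeWord.append_prod⟩

lemma inv_mem_reducedFrom (hg : g ∈ ReducedFrom M i j) : g⁻¹ ∈ ReducedFrom M j i := by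
  obtain ⟨w, rfl⟩ := hg
  exact ⟨w.inv, w.inv_prod⟩

lemma ne_one_of_mem_reducedFrom (hg : g ∈ ReducedFrom M i j) : g ≠ 1 := by
  classical
  obtain ⟨w, rfl⟩ := hg
  intro h
  have h1 : w.toWord = Word.empty := Word.equiv.symm.injective (by
    change w.toWord.prod = Word.empty.prod
    rw [Word.prod_empty]
    exact h)
  exact w.toList_ne_nil (congrArg Word.toList h1)

lemma exists_mem_reducedFrom (hg : g ≠ 1) : ∃ i j, g ∈ ReducedFrom M i j := by
  classical
  obtain ⟨i, j, w, hw⟩ := NeWord.of_word (Word.equiv g) fun h ↦ hg <| by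
    rw [← Word.equiv.symm_apply_apply g, h]
    exact Word.prod_empty
  refine ⟨i, j, w, ?_⟩
  rw [NeWord.prod, hw]
  exact Word.equiv.symm_apply_apply g

lemma exists_eq_of_mul (hg : g ∈ ReducedFrom M i j) :
    ∃ a : M i, a ≠ 1 ∧ ((i = j ∧ g = of a) ∨ ∃ k, k ≠ i ∧ ∃ h ∈ ReducedFrom M k j, g = of a * h) := by
  obtain ⟨w, rfl⟩ := hg
  induction w with
  | singleton x hx => exact ⟨x, hx, .inl ⟨rfl, NeWord.prod_singleton x hx⟩⟩
  | @append i j k l w₁ hne w₂ ih _ =>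
    obtain ⟨a, ha, ⟨rfl, h⟩ | ⟨m, hm, h, hh, h'⟩⟩ := ih
    · exact ⟨a, ha, .inr ⟨k, hne.symm, _, ⟨w₂, rfl⟩, by rw [NeWord.append_prod, h]⟩⟩
    · exact ⟨a, ha, .inr ⟨m, hm, _, mul_mem_reducedFrom hh hne ⟨w₂, rfl⟩, by
        rw [NeWord.append_prod, h', mul_assoc]⟩⟩

lemma of_notMem_reducedFrom (hij : i ≠ j) (x : M i) : of x ∉ ReducedFrom M j j := by
  intro h
  by_cases hx : x = 1
  · exact ne_one_of_mem_reducedFrom h (by rw [hx, map_one])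
  · refine ne_one_of_mem_reducedFrom
      (mul_mem_reducedFrom (of_mem_reducedFrom (inv_ne_one.2 hx)) hij h) ?_
    rw [← map_mul, inv_mul_cancel, map_one]

lemma of_mul_mul_mem_reducedFrom {x y : M i} (hx : x ≠ 1) (hij : i ≠ j)
    (hg : g ∈ ReducedFrom M j j) (hy : y ≠ 1) : of x * g * of y ∈ ReducedFrom M i i :=
  mul_mem_reducedFrom (mul_mem_reducedFrom (of_mem_reducedFrom hx) hij hg) hij.symm
    (of_mem_reducedFrom hy)

lemma of_mul_mul_of_inv_mem_reducedFrom {x : M i} (hx : x ≠ 1) (hij : i ≠ j)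
    (hg : g ∈ ReducedFrom M j j) : of x * g * (of x)⁻¹ ∈ ReducedFrom M i i := by
  rw [← map_inv]
  exact of_mul_mul_mem_reducedFrom hx hij hg (inv_ne_one.2 hx)

section TwoFactors

variable (hij : i ≠ j) (hall : ∀ k, k = i ∨ k = j)
include hij hall

/-- An element `y` with `y U y⁻¹ ⊆ U`, where `U` is the set of elements whose reduced words start
and end in the factor `j`, and which moves the given element `g ≠ 1` to `U`. -/
lemma exists_conj_mem_reducedFrom_single (p : Fin 3 → M i) (hp : Function.Injective p)
    {b : M j} (hb : b ≠ 1) (hg : g ≠ 1) :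
    ∃ y : CoprodI M, y * g * y⁻¹ ∈ ReducedFrom M j j ∧
      ∀ u ∈ ReducedFrom M j j, y * u * y⁻¹ ∈ ReducedFrom M j j := by
  -- This is where three elements in the factor `i` are needed.
  have havoid : ∀ a : M i, ∃ x : M i, x ≠ 1 ∧ x ≠ a := by
    intro a
    by_contra! hcon
    have h0 : ∀ m, p m = 1 ∨ p m = a := fun m ↦ or_iff_not_imp_left.2 (hcon (p m))
    have h01 := hp.ne (show (0 : Fin 3) ≠ 1 by decide)
    have h02 := hp.ne (show (0 : Fin 3) ≠ 2 by decide)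
    have h12 := hp.ne (show (1 : Fin 3) ≠ 2 by decide)
    rcases h0 0 with h | h <;> rcases h0 1 with h' | h' <;> rcases h0 2 with h'' | h'' <;>
      simp_all
  have hpres : ∀ x : M i, x ≠ 1 → ∀ u ∈ ReducedFrom M j j,
      (of b * of x) * u * (of b * of x)⁻¹ ∈ ReducedFrom M j j := by
    intro x hx u hu
    have := of_mul_mul_of_inv_mem_reducedFrom hb hij.symm
      (of_mul_mul_of_inv_mem_reducedFrom hx hij hu)
    convert this using 1
    group
  have hstep : ∀ x : M i, x ≠ 1 → of x * g * (of x)⁻¹ ∈ ReducedFrom M i i →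
      ∃ y : CoprodI M, y * g * y⁻¹ ∈ ReducedFrom M j j ∧
      ∀ u ∈ ReducedFrom M j j, y * u * y⁻¹ ∈ ReducedFrom M j j := by
    intro x hx h
    refine ⟨of b * of x, ?_, hpres x hx⟩
    have := of_mul_mul_of_inv_mem_reducedFrom hb hij.symm h
    convert this using 1
    group
  have hsplit : ∀ h ∈ ReducedFrom M i j, ∃ a : M i, a ≠ 1 ∧ ∃ u ∈ ReducedFrom M j j,
      h = of a * u := by
    intro h hh
    obtain ⟨a, ha, ⟨h', -⟩ | ⟨k, hk, u, hu, h'⟩⟩ := exists_eq_of_mul hh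
    · exact (hij h').elim
    · obtain rfl : k = j := (hall k).resolve_left hk
      exact ⟨a, ha, u, hu, h'⟩
  have hIJ : ∀ h ∈ ReducedFrom M i j, ∃ x : M i, x ≠ 1 ∧
      of x * h * (of x)⁻¹ ∈ ReducedFrom M i i := by
    intro h hh
    obtain ⟨a, ha, u, hu, rfl⟩ := hsplit h hh
    obtain ⟨x, hx, hxa⟩ := havoid a⁻¹
    refine ⟨x, hx, ?_⟩
    have := of_mul_mul_mem_reducedFrom (x := x * a) (y := x⁻¹)
      (fun h ↦ hxa (eq_inv_of_mul_eq_one_left h)) hij hu (inv_ne_one.2 hx)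
    simpa only [map_mul, map_inv, mul_assoc] using this
  obtain ⟨m, n, hmn⟩ := exists_mem_reducedFrom hg
  rcases hall m with hm | hm <;> rcases hall n with hn | hn <;> rw [hm, hn] at hmn
  · obtain ⟨a, ha, ⟨-, h'⟩ | ⟨k, hk, u, hu, h'⟩⟩ := exists_eq_of_mul hmn
    · obtain ⟨x, hx, -⟩ := havoid 1
      refine hstep x hx ?_
      rw [h', ← map_inv, ← map_mul, ← map_mul]
      exact of_mem_reducedFrom (by simpa using ha)
    · rw [(hall k).resolve_left hk] at hu
      obtain ⟨c, hc, v, hv, huv⟩ := hsplit _ (inv_mem_reducedFrom hu)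
      obtain rfl : u = v⁻¹ * of c⁻¹ := by rw [map_inv, ← mul_inv_rev, ← huv, inv_inv]
      have hv' := inv_mem_reducedFrom hv
      generalize v⁻¹ = v' at *
      have hc' : c⁻¹ ≠ 1 := inv_ne_one.2 hc
      generalize c⁻¹ = c' at *
      -- Here `g = a v' c'` with `v'` starting and ending in `j`. If `c'` is inverse to `a`, then
      -- `g` is a conjugate of `v'`; otherwise conjugation by `b a⁻¹` merges the outer letters into
      -- `c' a`.
      by_cases hac : c' * a = 1
      · obtain ⟨x, hx, hxa⟩ := havoid a⁻¹
        refine hstep x hx ?_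
        have := of_mul_mul_of_inv_mem_reducedFrom (x := x * a)
          (fun h ↦ hxa (eq_inv_of_mul_eq_one_left h)) hij hv'
        rw [h', eq_inv_of_mul_eq_one_left hac]
        convert this using 1
        simp only [map_mul, map_inv]
        group
      · have hconj : (of b * of a⁻¹) * g * (of b * of a⁻¹)⁻¹ =
            (of b * v') * (of (c' * a) * of b⁻¹) := by
          rw [h']
          simp only [map_mul, map_inv]
          group
        have htail : of (c' * a) * of b⁻¹ ∈ ReducedFrom M i j :=
          mul_mem_reducedFrom (of_mem_reducedFrom hac) hij
            (of_mem_reducedFrom (inv_ne_one.2 hb))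
        -- `b` may cancel the first letter of `v'`; the word then starts in `i` and ends in `j`,
        -- which `hIJ` repairs.
        have hcases : (of b * v') * (of (c' * a) * of b⁻¹) ∈ ReducedFrom M j j ∨
            (of b * v') * (of (c' * a) * of b⁻¹) ∈ ReducedFrom M i j := by
          obtain ⟨d, hd, ⟨-, h''⟩ | ⟨n, hn, w, hw, h''⟩⟩ := exists_eq_of_mul hv'
          · rw [h'', ← map_mul]
            by_cases hbd : b * d = 1
            · right
              rwa [hbd, map_one, one_mul]
            · left
              exact mul_mem_reducedFrom (of_mem_reducedFrom hbd) hij.symm htail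
          · rw [(hall n).resolve_right hn] at hw
            rw [h'', ← mul_assoc (of b), ← map_mul]
            by_cases hbd : b * d = 1
            · right
              rw [hbd, map_one, one_mul]
              exact mul_mem_reducedFrom hw hij.symm htail
            · left
              exact mul_mem_reducedFrom (mul_mem_reducedFrom (of_mem_reducedFrom hbd) hij.symm hw)
                hij.symm htail
        have ha' : a⁻¹ ≠ 1 := inv_ne_one.2 ha
        rcases hcases with hcase | hcase
        · exact ⟨of b * of a⁻¹, hconj ▸ hcase, hpres _ ha'⟩
        · obtain ⟨x, hx, hmem⟩ := hIJ _ hcase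
          refine ⟨(of b * of x) * (of b * of a⁻¹), ?_, fun u hu ↦ ?_⟩
          · have := of_mul_mul_of_inv_mem_reducedFrom hb hij.symm hmem
            rw [← hconj] at this
            convert this using 1
            group
          · have := hpres x hx _ (hpres _ ha' u hu)
            convert this using 1
            group
  · obtain ⟨x, hx, h⟩ := hIJ g hmn
    exact hstep x hx h
  · obtain ⟨x, hx, h⟩ := hIJ _ (inv_mem_reducedFrom hmn)
    refine hstep x hx ?_
    have := inv_mem_reducedFrom h
    convert this using 1
    group
  · exact ⟨1, by simpa using hmn, by simp⟩

/-- The elements are moved one at a time; each later conjugator preserves what the earlier ones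
achieved. -/
lemma exists_conj_mem_reducedFrom (p : Fin 3 → M i) (hp : Function.Injective p)
    {b : M j} (hb : b ≠ 1) (D : Finset (CoprodI M)) (hD : ∀ g ∈ D, g ≠ 1) :
    ∃ q : CoprodI M, ∀ g ∈ D, q * g * q⁻¹ ∈ ReducedFrom M j j := by
  classical
  induction D using Finset.induction_on with
  | empty => exact ⟨1, by simp⟩
  | insert g D _ ih =>
    obtain ⟨q, hq⟩ := ih fun g hg ↦ hD g (Finset.mem_insert_of_mem hg)
    obtain ⟨y, hy, hyU⟩ := exists_conj_mem_reducedFrom_single (g := q * g * q⁻¹) hij hall p hp hb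
      (by simpa using hD g (Finset.mem_insert_self _ _))
    refine ⟨y * q, fun g' hg' ↦ ?_⟩
    have key : (y * q) * g' * (y * q)⁻¹ = y * (q * g' * q⁻¹) * y⁻¹ := by group
    rw [key]
    rcases Finset.mem_insert.1 hg' with rfl | hg'
    · exact hy
    · exact hyU _ (hq g' hg')

end TwoFactors

end Monoid.CoprodI

/-! ### Alternating products in free groups and free products -/

/-- A family `z` of elements of a group such that no nonempty alternating product
`(z x₁)⁻¹ * z x₂ * (z x₃)⁻¹ * z x₄ * ⋯` with consecutive `xᵢ` distinct is trivial. -/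
def AlternatingFree {G X : Type*} [Group G] (z : X → G) : Prop :=
  ∀ (e f : ℕ → X) (g : ℕ → G), (∀ n, f n ≠ e n) → (∀ n, e (n + 1) ≠ f n) →
    (∀ n, z (e (n + 1)) * g (n + 1) = z (f n) * g n) → ∀ m, g (m + 1) ≠ g 0

/-- Any finite set `D` of nontrivial elements has three conjugates such that alternating products
of elements of these conjugates are nontrivial. -/
def HasAlternatingConjugates (G : Type*) [Group G] : Prop :=
  ∀ D : Finset G, (∀ g ∈ D, g ≠ 1) → ∃ x : Fin 3 → G, ∀ (k : ℕ → Fin 3) (u h : ℕ → G),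
    (∀ n, u n ∈ D) → (∀ n, k (n + 1) ≠ k n) →
    (∀ n, h (n + 1) = x (k n) * u n * (x (k n))⁻¹ * h n) → ∀ m, h (m + 1) ≠ h 0

lemma AlternatingFree.comp {G X Y : Type*} [Group G] {z : X → G} (hz : AlternatingFree z)
    {f : Y → X} (hf : Function.Injective f) : AlternatingFree (z ∘ f) :=
  fun e e' g h1 h2 h3 ↦ hz (f ∘ e) (f ∘ e') g (fun n ↦ hf.ne (h1 n)) (fun n ↦ hf.ne (h2 n)) h3

/-- Inverse and positive letters alternate, and neighbours carry distinct generators, so the word is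
already reduced. -/
lemma alternatingFree_of_freeGroup {G X : Type*} [Group G] (φ : FreeGroup X →* G)
    (hφ : Function.Injective φ) : AlternatingFree fun x ↦ φ (FreeGroup.of x) := by
  classical
  intro e f g hef hfe hg
  have key : ∀ m, ∃ L : List (X × Bool), FreeGroup.IsReduced ((e (m + 1), false) :: L) ∧
      g (m + 1) = φ (FreeGroup.mk ((e (m + 1), false) :: L)) * g 0 := by
    intro m
    have hstep : ∀ n, g (n + 1) =
        φ (FreeGroup.mk [(e (n + 1), false), (f n, true)]) * g n := by
      intro n
      have : FreeGroup.mk [(e (n + 1), false), (f n, true)] =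
          (FreeGroup.of (e (n + 1)))⁻¹ * FreeGroup.of (f n) := rfl
      rw [this, map_mul, map_inv, mul_assoc, ← hg n, inv_mul_cancel_left]
    induction m with
    | zero =>
      refine ⟨[(f 0, true)], ?_, hstep 0⟩
      simp [FreeGroup.IsReduced, hfe 0]
    | succ m ih =>
      obtain ⟨L, hL, hgL⟩ := ih
      refine ⟨(f (m + 1), true) :: (e (m + 1), false) :: L, ?_, ?_⟩
      · simp only [FreeGroup.IsReduced, List.isChain_cons_cons] at hL ⊢
        exact ⟨fun h ↦ (hfe _ h).elim, fun h ↦ (hef _ h).elim, hL⟩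
      · rw [hstep, hgL, ← mul_assoc, ← map_mul, FreeGroup.mul_mk]
        rfl
  intro m hm
  obtain ⟨L, hL, hgL⟩ := key m
  rw [hm, eq_comm, mul_eq_right, map_eq_one_iff φ hφ] at hgL
  have := hL.reduce_eq
  rw [← FreeGroup.toWord_mk, hgL] at this
  simp at this

namespace Monoid.CoprodI

variable {ι : Type*} {M : ι → Type*} [∀ i, Group (M i)] {i j : ι} {G : Type*} [Group G]

/-- Conjugate `D` by `q` into words starting and ending in `j`, then by the three letters `p k` of
the factor `i`. Between consecutive conjugates the nontrivial letter `(p k')⁻¹ p k` remains, so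
nothing cancels. -/
lemma exists_alternating_conjugates (hij : i ≠ j) (hall : ∀ k, k = i ∨ k = j)
    (φ : CoprodI M →* G) (hφ : Function.Injective φ) (p : Fin 3 → M i)
    (hp : Function.Injective p) {b : M j} (hb : b ≠ 1) (D : Finset G) (hD : ∀ g ∈ D, g ≠ 1)
    (hDφ : ∀ g ∈ D, g ∈ φ.range) :
    ∃ x : Fin 3 → G, ∀ (k : ℕ → Fin 3) (u h : ℕ → G),
    (∀ n, u n ∈ D) → (∀ n, k (n + 1) ≠ k n) →
    (∀ n, h (n + 1) = x (k n) * u n * (x (k n))⁻¹ * h n) → ∀ m, h (m + 1) ≠ h 0 := by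
  classical
  choose! ψ hψ using hDφ
  obtain ⟨q, hq⟩ := exists_conj_mem_reducedFrom hij hall p hp hb (D.image ψ) (by
    intro g hg
    obtain ⟨d, hd, rfl⟩ := Finset.mem_image.1 hg
    intro h
    have := hψ d hd
    rw [h, map_one] at this
    exact hD d hd this.symm)
  refine ⟨fun k ↦ φ (of (p k) * q), fun k u h hu hk hh m hm ↦ ?_⟩
  have key : ∀ m, ∃ c ∈ ReducedFrom M j j,
      h (m + 1) = φ (of (p (k m)) * c * (of (p (k 0)))⁻¹) * h 0 := by
    intro m
    have hstep : ∀ n, h (n + 1) =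
        φ (of (p (k n)) * (q * ψ (u n) * q⁻¹) * (of (p (k n)))⁻¹) * h n := by
      intro n
      rw [hh, ← hψ _ (hu n), ← map_inv, ← map_mul, ← map_mul, hψ _ (hu n)]
      congr 2
      group
    have hmem : ∀ n, q * ψ (u n) * q⁻¹ ∈ ReducedFrom M j j :=
      fun n ↦ hq _ (Finset.mem_image_of_mem _ (hu n))
    induction m with
    | zero => exact ⟨_, hmem 0, hstep 0⟩
    | succ m ih =>
      obtain ⟨c, hc, hcm⟩ := ih
      refine ⟨(q * ψ (u (m + 1)) * q⁻¹) * of ((p (k (m + 1)))⁻¹ * p (k m)) * c, ?_, ?_⟩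
      · refine mul_mem_reducedFrom (mul_mem_reducedFrom (hmem _) hij.symm
          (of_mem_reducedFrom fun h ↦ ?_)) hij hc
        exact hk m (hp (inv_mul_eq_one.1 h))
      · rw [hstep, hcm, ← mul_assoc, ← map_mul]
        congr 2
        simp only [map_mul, map_inv]
        group
  obtain ⟨c, hc, hcm⟩ := key m
  rw [hm, eq_comm, mul_eq_right, map_eq_one_iff φ hφ] at hcm
  -- If the product were trivial, the core `c` would be an element of the factor `i`.
  refine of_notMem_reducedFrom hij ((p (k m))⁻¹ * p (k 0)) ?_
  convert hc using 1
  rw [map_mul, map_inv, inv_mul_eq_iff_eq_mul, ← mul_inv_eq_one, ← inv_eq_one, ← hcm]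
  group

/-- The family is `t ^ n * b * t ^ n`, where no power of `t` cancels. In an alternating product all
interior exponents of `t` are differences of distinct indices, hence nonzero, and the letters `b`
keep them apart. -/
lemma exists_alternatingFree (hij : i ≠ j)
    (φ : CoprodI M →* G) (hφ : Function.Injective φ) (p : Fin 3 → M i)
    (hp : Function.Injective p) {b : M j} (hb : b ≠ 1) : ∃ z : ℕ → G, AlternatingFree z := by
  -- The condition `a' * a ≠ 1` keeps the powers of `a b a'` reduced.
  obtain ⟨a, a', ha, ha', haa'⟩ : ∃ a a' : M i, a ≠ 1 ∧ a' ≠ 1 ∧ a' * a ≠ 1 := by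
    refine ⟨(p 0)⁻¹ * p 1, (p 2)⁻¹ * p 0, ?_, ?_, ?_⟩
    · rw [Ne, inv_mul_eq_one]; exact hp.ne (by decide)
    · rw [Ne, inv_mul_eq_one]; exact hp.ne (by decide)
    · rw [mul_assoc, mul_inv_cancel_left, Ne, inv_mul_eq_one]; exact hp.ne (by decide)
  set t : CoprodI M := of a * of b * of a' with ht
  have hb' := of_mem_reducedFrom hb
  have hpow : ∀ n : ℕ, t ^ (n + 1) ∈ ReducedFrom M i i := by
    have hpow' : ∀ n : ℕ, ∃ c ∈ ReducedFrom M i j, t ^ (n + 1) = c * of a' := by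
      intro n
      induction n with
      | zero => exact ⟨of a * of b, mul_mem_reducedFrom (of_mem_reducedFrom ha) hij hb', by
          rw [zero_add, pow_one]⟩
      | succ n ih =>
        obtain ⟨c, hc, hcn⟩ := ih
        refine ⟨c * of (a' * a) * of b, mul_mem_reducedFrom (mul_mem_reducedFrom hc hij.symm
          (of_mem_reducedFrom haa')) hij hb', ?_⟩
        rw [pow_succ, hcn, ht, map_mul]
        group
    intro n
    obtain ⟨c, hc, hcn⟩ := hpow' n
    rw [hcn]
    exact mul_mem_reducedFrom hc hij.symm (of_mem_reducedFrom ha')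
  have hzpow : ∀ d : ℤ, d ≠ 0 → t ^ d ∈ ReducedFrom M i i := by
    intro d hd
    rcases lt_or_gt_of_ne hd with h | h
    · obtain ⟨n, hn⟩ := Int.exists_eq_neg_ofNat h.le
      obtain ⟨n, rfl⟩ := Nat.exists_eq_succ_of_ne_zero (show n ≠ 0 by omega)
      rw [hn, zpow_neg, zpow_natCast]
      exact inv_mem_reducedFrom (hpow n)
    · obtain ⟨n, rfl⟩ := Int.eq_ofNat_of_zero_le h.le
      obtain ⟨n, rfl⟩ := Nat.exists_eq_succ_of_ne_zero (show n ≠ 0 by omega)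
      rw [zpow_natCast]
      exact hpow n
  let v : ℤ → CoprodI M := fun n ↦ t ^ n * of b * t ^ n
  refine ⟨fun n ↦ φ (v n), fun e f g hef hfe hg m hm ↦ ?_⟩
  have hstep : ∀ n, g (n + 1) = φ ((v (e (n + 1)))⁻¹ * v (f n)) * g n := by
    intro n
    rw [map_mul, map_inv, mul_assoc, ← hg n, inv_mul_cancel_left]
  have hcore : ∀ n, (of b)⁻¹ * t ^ (f n - e (n + 1) : ℤ) * of b ∈ ReducedFrom M j j := fun n ↦
    mul_mem_reducedFrom (mul_mem_reducedFrom (inv_mem_reducedFrom hb') hij.symm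
      (hzpow _ (by have := hfe n; omega))) hij hb'
  have key : ∀ m, ∃ c ∈ ReducedFrom M j j,
      g (m + 1) = φ (t ^ (-e (m + 1) : ℤ) * c * t ^ (f 0 : ℤ)) * g 0 := by
    intro m
    induction m with
    | zero =>
      refine ⟨_, hcore 0, ?_⟩
      rw [hstep]
      simp only [v]
      congr 2
      group
    | succ m ih =>
      obtain ⟨c, hc, hcm⟩ := ih
      refine ⟨_, mul_mem_reducedFrom (mul_mem_reducedFrom (hcore (m + 1)) hij.symm
        (hzpow (f (m + 1) - e (m + 1)) (by have := hef (m + 1); omega))) hij hc, ?_⟩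
      rw [hstep, hcm, ← mul_assoc, ← map_mul]
      simp only [v]
      congr 2
      group
  obtain ⟨c, hc, hcm⟩ := key m
  rw [hm, eq_comm, mul_eq_right, map_eq_one_iff φ hφ] at hcm
  have hc' : c = t ^ (e (m + 1) - f 0 : ℤ) := by
    have : c = t ^ (e (m + 1) : ℤ) * (t ^ (-e (m + 1) : ℤ) * c * t ^ (f 0 : ℤ)) *
        t ^ (-f 0 : ℤ) := by group
    rw [this, hcm]
    group
  by_cases hd : (e (m + 1) - f 0 : ℤ) = 0
  · rw [hd, zpow_zero] at hc'
    exact ne_one_of_mem_reducedFrom hc hc'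
  · have h1 := inv_mem_reducedFrom (hzpow _ hd)
    exact ne_one_of_mem_reducedFrom (mul_mem_reducedFrom h1 hij hc) (by rw [hc']; group)

end Monoid.CoprodI

/-! ### Alternating families in locally strict free products -/

/-- The free product of two groups as a free product of a family indexed by `Bool`. -/
def coprodMulEquivCoprodI (M : Bool → Type*) [∀ i, Group (M i)] :
    Monoid.Coprod (M true) (M false) ≃* Monoid.CoprodI M :=
  MonoidHom.toMulEquiv
    (Monoid.Coprod.lift Monoid.CoprodI.of Monoid.CoprodI.of)
    (Monoid.CoprodI.lift fun i ↦ match i with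
      | true => Monoid.Coprod.inl
      | false => Monoid.Coprod.inr)
    (by ext <;> simp)
    (by ext i x; cases i <;> simp)

lemma exists_injective_fin_three {A : Type*} [Group A] [Nontrivial A] (hA : Nat.card A ≠ 2) :
    ∃ p : Fin 3 → A, Function.Injective p := by
  have h3 : 3 ≤ Cardinal.mk A := by
    rcases finite_or_infinite A with h | h
    · have h1 : 1 < Nat.card A := Finite.one_lt_card
      rw [← Nat.cast_card]
      exact_mod_cast (show 3 ≤ Nat.card A by omega)
    · exact (Cardinal.natCast_lt_aleph0 (n := 3)).le.trans (Cardinal.aleph0_le_mk A)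
  obtain ⟨f⟩ : Nonempty (Fin 3 ↪ A) := by
    rw [← Cardinal.lift_mk_le']
    simpa using h3
  exact ⟨f, f.injective⟩

/-- Groups of order two are isomorphic, so strictness gives a factor with at least three elements;
it is labelled `i`. -/
lemma IsStrictFreeProduct.exists_coprodI {N : Type u} [Group N] (hN : IsStrictFreeProduct N) :
    ∃ (M : Bool → Type u) (_ : ∀ i, Group (M i)) (i j : Bool), i ≠ j ∧ (∀ k, k = i ∨ k = j) ∧
      (∃ p : Fin 3 → M i, Function.Injective p) ∧ (∃ b : M j, b ≠ 1) ∧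
      Nonempty (Monoid.CoprodI M ≃* N) := by
  obtain ⟨A, B, _, _, hA, hB, hne, ⟨e⟩⟩ := hN
  let M : Bool → Type u := fun i ↦ match i with
    | true => A
    | false => B
  let inst : ∀ i, Group (M i) := fun i ↦ match i with
    | true => inferInstanceAs (Group A)
    | false => inferInstanceAs (Group B)
  have e' : Nonempty (Monoid.CoprodI M ≃* N) :=
    ⟨(coprodMulEquivCoprodI M).symm.trans e.symm⟩
  by_cases h2 : Nat.card A = 2
  · have hB2 : Nat.card B ≠ 2 := by
      intro hB2
      have hZ : Nat.card (Multiplicative (ZMod 2)) = 2 := by simp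
      exact hne ⟨MulEquiv.coprodCongr
        (mulEquivOfPrimeCardEq (p := 2) h2 hZ) (mulEquivOfPrimeCardEq (p := 2) hB2 hZ)⟩
    exact ⟨M, inst, false, true, by decide, by decide, exists_injective_fin_three (A := B) hB2,
      exists_ne (1 : A), e'⟩
  · exact ⟨M, inst, true, false, by decide, by decide, exists_injective_fin_three (A := A) h2,
      exists_ne (1 : B), e'⟩

lemma IsLocallyStrictFreeProduct.hasAlternatingConjugates {G : Type u} [Group G]
    (hG : IsLocallyStrictFreeProduct G) : HasAlternatingConjugates G := by
  intro D hD
  obtain ⟨H, hDH, hH⟩ := hG D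
  obtain ⟨M, _, i, j, hij, hall, ⟨p, hp⟩, ⟨b, hb⟩, ⟨e⟩⟩ := hH.exists_coprodI
  refine Monoid.CoprodI.exists_alternating_conjugates hij hall
    (H.subtype.comp e.toMonoidHom) (H.subtype_injective.comp e.injective) p hp hb D hD ?_
  intro g hg
  exact ⟨e.symm ⟨g, hDH hg⟩, by simp⟩

lemma IsLocallyStrictFreeProduct.exists_alternatingFree_nat {G : Type u} [Group G]
    (hG : IsLocallyStrictFreeProduct G) : ∃ z : ℕ → G, AlternatingFree z := by
  obtain ⟨H, -, hH⟩ := hG ∅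
  obtain ⟨M, _, i, j, hij, hall, ⟨p, hp⟩, ⟨b, hb⟩, ⟨e⟩⟩ := hH.exists_coprodI
  exact Monoid.CoprodI.exists_alternatingFree hij
    (H.subtype.comp e.toMonoidHom) (H.subtype_injective.comp e.injective) p hp hb

lemma AlternatingFree.injective {G X : Type*} [Group G] {z : X → G} (hz : AlternatingFree z) :
    Function.Injective z := by
  intro x y hxy
  by_contra hne
  exact hz (fun _ ↦ x) (fun _ ↦ y) (fun _ ↦ 1) (fun _ ↦ fun h ↦ hne h.symm) (fun _ ↦ hne)
    (fun _ ↦ by rw [hxy]) 0 rfl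

/-- An uncountable free group has rank equal to its cardinality. If `G` is countable, the free
subgroup may be cyclic, so the sequence found inside a free product replaces its basis. -/
lemma exists_alternatingFree_card_eq {G : Type u} [Group G] (hG : IsLocallyStrictFreeProduct G)
    (hF : ∃ F : Subgroup G, IsFreeGroup F ∧ Cardinal.mk F = Cardinal.mk G) :
    ∃ (X : Type u) (z : X → G), AlternatingFree z ∧ Cardinal.mk X = Cardinal.mk G := by
  obtain ⟨z, hz⟩ := hG.exists_alternatingFree_nat
  have : Infinite G := Infinite.of_injective z hz.injective
  rcases (Cardinal.aleph0_le_mk G).eq_or_lt with h | h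
  · exact ⟨ULift ℕ, z ∘ ULift.down, hz.comp ULift.down_injective, by simpa using h⟩
  · obtain ⟨F, hF, hcard⟩ := hF
    let e := IsFreeGroup.toFreeGroup F
    refine ⟨IsFreeGroup.Generators F, _, alternatingFree_of_freeGroup
      (F.subtype.comp e.symm.toMonoidHom) (F.subtype_injective.comp e.symm.injective), ?_⟩
    have h1 : Cardinal.mk (FreeGroup (IsFreeGroup.Generators F)) = Cardinal.mk G :=
      (Cardinal.mk_congr e.toEquiv.symm).trans hcard
    rcases isEmpty_or_nonempty (IsFreeGroup.Generators F) with hE | hE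
    · rw [← h1] at h
      have : Cardinal.mk (FreeGroup (IsFreeGroup.Generators F)) ≤ 1 :=
        Cardinal.le_one_iff_subsingleton.2 inferInstance
      exact absurd (h.trans_le this) (not_lt.2 (Cardinal.one_lt_aleph0.le))
    · rw [Cardinal.mk_freeGroup] at h1
      rcases le_total (Cardinal.mk (IsFreeGroup.Generators F)) Cardinal.aleph0 with h2 | h2
      · rw [max_eq_right h2] at h1
        exact absurd h1 h.ne
      · rwa [max_eq_left h2] at h1

/-! ### Supports and cancellation in group rings -/

namespace MonoidAlgebra

open Finset

variable {R G : Type*} [Ring R] [Group G]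

/-- Translating the members of a finite family in `R[G]` by an alternating-free family of group
elements creates so little cancellation that a sum equal to `1` bounds the sizes of the supports by
twice the size of their union. -/
lemma sum_card_support_le {X : Type*} {z : X → G} (hz : AlternatingFree z) (T : Finset X)
    (γ : X → MonoidAlgebra R G) (hsum : ∑ x ∈ T, single (z x) 1 * γ x = 1) [DecidableEq G] :
    ∑ x ∈ T, #(γ x).coeff.support ≤ 2 * #(T.biUnion fun x ↦ (γ x).coeff.support) + 2 := by
  classical
  set U := T.biUnion fun x ↦ (γ x).coeff.support with hU
  -- Each term of the sum is an edge, joining its support element `g` to the product `z x * g`.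
  let E : Finset (Σ _ : X, G) := T.sigma fun x ↦ (γ x).coeff.support
  let r : (Σ _ : X, G) → G := fun e ↦ z e.1 * e.2
  have hE : ∀ e, e ∈ E ↔ e.1 ∈ T ∧ (γ e.1).coeff e.2 ≠ 0 := fun e ↦ by simp [E]
  have h1 : #E ≤ #(E.image Sigma.snd) + #(E.image r) := by
    refine card_le_of_no_closed_walk Sigma.snd r E fun e f _ _ hl hne hr hne' m hm ↦ ?_
    refine hz (fun n ↦ (e n).1) (fun n ↦ (f n).1) (fun n ↦ (e n).2) (fun n h ↦ ?_)
      (fun n h ↦ ?_) (fun n ↦ ?_) m (by simp only [hm])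
    · exact hne n (Sigma.ext h (heq_of_eq (hl n)))
    · refine hne' n (Sigma.ext h (heq_of_eq ?_))
      have := hr n
      simp only [r, h] at this
      exact mul_left_cancel this
    · simpa only [r, hl] using hr n
  have h2 : E.image Sigma.snd ⊆ U := by
    intro g hg
    obtain ⟨e, he, rfl⟩ := mem_image.1 hg
    exact mem_biUnion.2 ⟨e.1, mem_sigma.1 he⟩
  have hcoeff : ∀ w, ∑ x ∈ T, (γ x).coeff ((z x)⁻¹ * w) = (1 : MonoidAlgebra R G).coeff w := by
    intro w
    rw [← hsum]
    simp [coeff_sum]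
  -- A product other than 1 has total coefficient zero, so at least two terms meet there. The
  -- exception at 1 costs the `+ 2` in the bound.
  have h3 : 2 * #((E.image r).erase 1) ≤ #E := by
    refine two_mul_card_image_le r E _ (erase_subset _ _) fun e he her ↦ ?_
    by_contra! hcon
    have her1 : r e ≠ 1 := (mem_erase.1 her).1
    have h4 := hcoeff (r e)
    rw [sum_eq_single_of_mem e.1 ((hE e).1 he).1] at h4
    · apply ((hE e).1 he).2
      rw [one_def, coeff_single, Finsupp.single_apply, if_neg her1.symm] at h4
      simpa [r] using h4
    · intro x hx hxe
      by_contra hne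
      refine hcon ⟨x, (z x)⁻¹ * r e⟩ ((hE _).2 ⟨hx, hne⟩) (fun h ↦ hxe ?_) ?_
      · exact congrArg Sigma.fst h
      · simp [r]
  have h4 : #(E.image r) ≤ #((E.image r).erase 1) + 1 := by
    have := pred_card_le_card_erase (s := E.image r) (a := 1)
    omega
  have h5 : #E = ∑ x ∈ T, #(γ x).coeff.support := card_sigma _ _
  have h6 := card_le_card h2
  omega

/-- A coefficient of a product at a group element which is in a unique way a product of elements of
the supports. -/
lemma coeff_mul_of_unique {S : Type*} [Ring S] (α β : MonoidAlgebra S G) {f h : G}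
    (hf : f ∈ α.coeff.support) (hu : ∀ f' ∈ α.coeff.support, ∀ h' ∈ β.coeff.support,
      f' * h' = f * h → f' = f) :
    (α * β).coeff (f * h) = α.coeff f * β.coeff h := by
  rw [coeff_mul_apply_left, Finsupp.sum, sum_eq_single_of_mem f hf]
  · rw [inv_mul_cancel_left]
  · intro f' hf' hne
    by_contra hcon
    refine hne (hu f' hf' (f'⁻¹ * (f * h)) (Finsupp.mem_support_iff.2 fun h0 ↦ hcon ?_) (by group))
    rw [h0, mul_zero]

/-- Multiplication from the left by `α a₀`, `α a₁`, `α a₂` for suitable group elements does not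
shrink supports on average. -/
lemma exists_card_support_le [IsDomain R] (hG : HasAlternatingConjugates G)
    {α : MonoidAlgebra R G} (hα : α ≠ 0) :
    ∃ a : Fin 3 → G, ∀ β : MonoidAlgebra R G,
      #β.coeff.support ≤ ∑ k, #(α * single (a k) 1 * β).coeff.support := by
  classical
  set M := α.coeff.support with hM
  obtain ⟨f₀, hf₀⟩ : M.Nonempty := Finsupp.support_nonempty_iff.2 (by simpa using hα)
  let Q : Finset G := (M ×ˢ M).image fun f ↦ f.1⁻¹ * f.2
  -- Two points of a cluster are joined through its centre by four steps of `rel`, each contributing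
  -- a factor from `Q`.
  let D : Finset G :=
    ((Q ×ˢ Q ×ˢ Q ×ˢ Q).image fun q ↦ q.1 * q.2.1 * q.2.2.1 * q.2.2.2).erase 1
  obtain ⟨x, hx⟩ := hG D fun g hg ↦ (mem_erase.1 hg).1
  refine ⟨fun k ↦ (x k)⁻¹, fun β ↦ ?_⟩
  set B := β.coeff.support with hB
  let rel : Fin 3 → G → G → Prop := fun k h h' ↦
    ∃ f ∈ M, ∃ f' ∈ M, f * (x k)⁻¹ * h = f' * (x k)⁻¹ * h'
  have hrefl : ∀ k h, rel k h h := fun k h ↦ ⟨f₀, hf₀, f₀, hf₀, rfl⟩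
  have hsymm : ∀ k h h', rel k h h' → rel k h' h :=
    fun k h h' ⟨f, hf, f', hf', he⟩ ↦ ⟨f', hf', f, hf, he.symm⟩
  have hrelQ : ∀ k h h', rel k h h' → (x k)⁻¹ * h * h'⁻¹ * x k ∈ Q := by
    rintro k h h' ⟨f, hf, f', hf', he⟩
    refine mem_image.2 ⟨(f, f'), mem_product.2 ⟨hf, hf'⟩, ?_⟩
    have : (x k)⁻¹ * h = f⁻¹ * (f' * (x k)⁻¹ * h') := by rw [← he]; group
    rw [this]
    group
  -- Only these elements of `B` can have a product that coincides with a product coming from another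
  -- element.
  let N : Fin 3 → Finset G := fun k ↦ B.filter fun h ↦ ∃ h' ∈ B, h' ≠ h ∧ rel k h h'
  have hN : ∀ k, ∀ h ∈ N k, ∃ h' ∈ N k, h' ≠ h ∧ rel k h h' := by
    intro k h hh
    obtain ⟨hhB, h', hh', hne, hr⟩ := mem_filter.1 hh
    exact ⟨h', mem_filter.2 ⟨hh', h, hhB, hne.symm, hsymm _ _ _ hr⟩, hne, hr⟩
  choose c hcfib hcdist using fun k ↦
    exists_cluster (N k) (rel k) (fun h _ ↦ hrefl k h) (hsymm k) (hN k)
  let E : Finset (Σ _ : Fin 3, G) := univ.sigma N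
  have hE : ∀ e, e ∈ E ↔ e.2 ∈ N e.1 := fun e ↦ by simp [E]
  -- Edges join `h` to its cluster for the index `k`; a closed walk would be a trivial alternating
  -- product of conjugates of `D`.
  let r : (Σ _ : Fin 3, G) → Fin 3 × G := fun e ↦ (e.1, c e.1 e.2)
  have h1 : #E ≤ #(E.image Sigma.snd) + #(E.image r) := by
    refine card_le_of_no_closed_walk Sigma.snd r E fun e f he hf hl hne hr hne' m hm ↦ ?_
    have hfst : ∀ n, (e (n + 1)).1 = (f n).1 := fun n ↦ congrArg Prod.fst (hr n)
    have hmem : ∀ n, (x (e (n + 1)).1)⁻¹ * (e (n + 1)).2 * ((e n).2)⁻¹ * x (e (n + 1)).1 ∈ D := by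
      intro n
      have hcc : c (e (n + 1)).1 (e (n + 1)).2 = c (e (n + 1)).1 (e n).2 := by
        have : c (e (n + 1)).1 (e (n + 1)).2 = c (f n).1 (f n).2 := congrArg Prod.snd (hr n)
        rw [this, hfst, hl]
      have hm1 := (hE _).1 (he (n + 1))
      have hm2 := (hE _).1 (hf n)
      rw [hl, ← hfst] at hm2
      refine mem_erase.2 ⟨fun h ↦ hne' n (Sigma.ext (hfst n) (heq_of_eq ?_)), ?_⟩
      · rw [hl]
        have h' : (e (n + 1)).2 * ((e n).2)⁻¹ = 1 := by
          rw [← conj_eq_one_iff (a := (x (e (n + 1)).1)⁻¹), inv_inv, ← mul_assoc]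
          exact h
        exact mul_inv_eq_one.1 h'
      · obtain ⟨-, p, -, hp1, hp2⟩ := hcdist _ _ hm1
        obtain ⟨-, p', -, hp3, hp4⟩ := hcdist _ _ hm2
        rw [← hcc] at hp4
        refine mem_image.2 ⟨(_, _, _, _), mem_product.2 ⟨hrelQ _ _ _ hp1, mem_product.2
          ⟨hrelQ _ _ _ hp2, mem_product.2 ⟨hrelQ _ _ _ (hsymm _ _ _ hp4),
            hrelQ _ _ _ (hsymm _ _ _ hp3)⟩⟩⟩, ?_⟩
        group
    refine hx (fun n ↦ (e (n + 1)).1)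
      (fun n ↦ (x (e (n + 1)).1)⁻¹ * (e (n + 1)).2 * ((e n).2)⁻¹ * x (e (n + 1)).1)
      (fun n ↦ (e n).2) hmem (fun n h ↦ ?_) (fun n ↦ by group) m (by simp only [hm])
    simp only [hfst (n + 1)] at h
    exact hne (n + 1) (Sigma.ext h (heq_of_eq (hl _)))
  have h2 : #(E.image Sigma.snd) ≤ #B := by
    refine card_le_card fun h hh ↦ ?_
    obtain ⟨e, he, rfl⟩ := mem_image.1 hh
    exact (mem_filter.1 ((hE e).1 he)).1
  have h3 : 2 * #(E.image r) ≤ #E := by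
    refine two_mul_card_image_le r E _ subset_rfl fun e he _ ↦ ?_
    obtain ⟨h, hh, hne, hc⟩ := hcfib e.1 e.2 ((hE e).1 he)
    exact ⟨⟨e.1, h⟩, (hE _).2 hh, fun h' ↦ hne (by rw [← h']), Prod.ext rfl hc⟩
  have h4 : #E = ∑ k, #(N k) := card_sigma _ _
  -- For `h` outside `N k` the product with `f₀` arises in one way only, and its coefficient is
  -- nonzero because `R` is a domain.
  have h5 : ∀ k, #B ≤ #(α * single (x k)⁻¹ 1 * β).coeff.support + #(N k) := by
    intro k
    have hsplit : #(B.filter fun h ↦ h ∉ N k) + #(N k) = #B := by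
      have := card_filter_add_card_filter_not (s := B) (fun h ↦ h ∈ N k)
      rw [filter_mem_eq_inter, inter_eq_right.2 (show N k ⊆ B from filter_subset _ _)] at this
      omega
    rw [← hsplit]
    refine Nat.add_le_add_right (card_le_card_of_injOn (fun h ↦ f₀ * (x k)⁻¹ * h) ?_ ?_) _
    · intro h hh
      obtain ⟨hhB, hhN⟩ := mem_filter.1 hh
      refine Finsupp.mem_support_iff.2 ?_
      have := coeff_mul_of_unique α (single (x k)⁻¹ 1 * β) (f := f₀) (h := (x k)⁻¹ * h) hf₀ ?_
      · change (α * single (x k)⁻¹ 1 * β).coeff (f₀ * (x k)⁻¹ * h) ≠ 0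
        rw [mul_assoc α, mul_assoc f₀, this, coeff_single_mul_mul, one_mul]
        exact mul_ne_zero (Finsupp.mem_support_iff.1 hf₀) (Finsupp.mem_support_iff.1 hhB)
      · intro f' hf' h' hh' heq
        by_contra hne
        refine hhN (mem_filter.2 ⟨hhB, x k * h', ?_, fun h'' ↦ hne ?_, f₀, hf₀, f', hf', ?_⟩)
        · simpa [hB] using hh'
        · rw [← h'', inv_mul_cancel_left] at heq
          exact mul_right_cancel heq
        · rw [mul_assoc f₀, ← heq]
          group
    · intro h _ h' _ heq
      exact mul_left_cancel heq
  -- Clusters have at least two points, so `h1`, `h2` and `h3` give `#E ≤ 2 * #B`. Summing `h5` over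
  -- three indices leaves one `#B` to spare.
  have h6 := sum_le_sum fun k (_ : k ∈ (univ : Finset (Fin 3))) ↦ h5 k
  rw [sum_add_distrib, sum_const, card_univ, Fintype.card_fin, smul_eq_mul] at h6
  change #B ≤ ∑ k, #(α * single (x k)⁻¹ 1 * β).coeff.support
  omega

end MonoidAlgebra

/-! ### The proper right ideal and primitivity -/

namespace MonoidAlgebra

open Finset

variable {R G : Type*} [Ring R] [IsDomain R] [Group G]

/-- The generators of a proper right ideal of `R[G]` which is comaximal to each two-sided ideal
containing some `δ i`. -/
noncomputable def comaximalGenerator {ι : Type*} (δ : ι → MonoidAlgebra R G)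
    (z : ι × Option (Fin 3 × Fin 6) → G) (a : ι → Fin 3 → G) (i : ι) : MonoidAlgebra R G :=
  single (z (i, none)) 1 + ∑ p : Fin 3 × Fin 6, single (z (i, some p)) 1 * (δ i * single (a i p.1) 1)

/-- The copies indexed by `Fin 6` count six times in the sum of the supports but only once in their
union. -/
lemma sum_comaximalGenerator_mul_ne_one {ι : Type*} {δ : ι → MonoidAlgebra R G}
    {z : ι × Option (Fin 3 × Fin 6) → G} (hz : AlternatingFree z) {a : ι → Fin 3 → G}
    (ha : ∀ i, ∀ β : MonoidAlgebra R G,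
      #β.coeff.support ≤ ∑ k, #(δ i * single (a i k) 1 * β).coeff.support)
    (T : Finset ι) (β : ι → MonoidAlgebra R G) :
    ∑ i ∈ T, comaximalGenerator δ z a i * β i ≠ 1 := by
  classical
  intro hsum
  let γ : ι × Option (Fin 3 × Fin 6) → MonoidAlgebra R G := fun x ↦
    x.2.elim (β x.1) fun p ↦ δ x.1 * single (a x.1 p.1) 1 * β x.1
  have h1 := sum_card_support_le hz (T ×ˢ univ) γ (by
    rw [← hsum, sum_product]
    refine sum_congr rfl fun i _ ↦ ?_
    rw [Fintype.sum_option, comaximalGenerator, add_mul, sum_mul]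
    simp only [γ, Option.elim, mul_assoc])
  have h2 : #((T ×ˢ univ).biUnion fun x ↦ (γ x).coeff.support) ≤
      ∑ i ∈ T, #(β i).coeff.support +
        ∑ i ∈ T, ∑ k, #(δ i * single (a i k) 1 * β i).coeff.support := by
    rw [← sum_add_distrib]
    refine (card_le_card (t := T.biUnion fun i ↦ (β i).coeff.support ∪
      univ.biUnion fun k ↦ (δ i * single (a i k) 1 * β i).coeff.support) ?_).trans ?_
    · intro g hg
      obtain ⟨⟨i, o⟩, hi, hg⟩ := mem_biUnion.1 hg
      refine mem_biUnion.2 ⟨i, (mem_product.1 hi).1, ?_⟩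
      cases o with
      | none => exact mem_union_left _ hg
      | some p => exact mem_union_right _ (mem_biUnion.2 ⟨p.1, mem_univ _, hg⟩)
    · exact card_biUnion_le.trans (sum_le_sum fun i _ ↦ (card_union_le _ _).trans
        (Nat.add_le_add_left card_biUnion_le _))
  have h3 : ∑ x ∈ T ×ˢ univ, #(γ x).coeff.support = ∑ i ∈ T, #(β i).coeff.support +
      6 * ∑ i ∈ T, ∑ k, #(δ i * single (a i k) 1 * β i).coeff.support := by
    rw [sum_product, mul_sum, ← sum_add_distrib]
    refine sum_congr rfl fun i _ ↦ ?_
    rw [Fintype.sum_option, Fintype.sum_prod_type]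
    simp [γ, mul_sum]
  have h4 : ∑ i ∈ T, #(β i).coeff.support ≤
      ∑ i ∈ T, ∑ k, #(δ i * single (a i k) 1 * β i).coeff.support :=
    sum_le_sum fun i _ ↦ ha i (β i)
  -- With B and S the two sums, B + 6S ≤ 2(B + S) + 2 and B ≤ S give 3S ≤ 2, so S = B = 0. Five
  -- copies would only give S ≤ 1.
  have h5 : ∑ i ∈ T, #(β i).coeff.support = 0 := by omega
  have h6 : ∀ i ∈ T, β i = 0 := fun i hi ↦ by
    simpa using sum_eq_zero_iff.1 h5 i hi
  rw [sum_congr rfl fun i hi ↦ by rw [h6 i hi, mul_zero], sum_const_zero] at hsum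
  exact zero_ne_one hsum

end MonoidAlgebra

open MonoidAlgebra in
/-- If every nonzero ideal of `R[G]` contains a member of a family of nonzero elements which is no
larger than an alternating-free family in `G`, then `R[G]` is primitive. -/
lemma isRightPrimitive_of_alternatingFree {R : Type v} {G : Type u} [Ring R] [IsDomain R]
    [Group G] (hG : HasAlternatingConjugates G) {ι : Type*} {δ : ι → MonoidAlgebra R G}
    (hδ : ∀ i, δ i ≠ 0) {z : ι × Option (Fin 3 × Fin 6) → G} (hz : AlternatingFree z)
    (hI : ∀ I : AddSubgroup (MonoidAlgebra R G), I ≠ ⊥ → (∀ x, ∀ y ∈ I, x * y ∈ I) →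
      (∀ x, ∀ y ∈ I, y * x ∈ I) → ∃ i, δ i ∈ I) :
    IsRightPrimitive (MonoidAlgebra R G) := by
  choose a ha using fun i ↦ exists_card_support_le hG (hδ i)
  let ρ : Ideal (MonoidAlgebra R G)ᵐᵒᵖ :=
    Ideal.span (Set.range fun i ↦ MulOpposite.op (comaximalGenerator δ z a i))
  have hρ : ρ ≠ ⊤ := by
    intro h
    rw [Ideal.eq_top_iff_one, Finsupp.mem_ideal_span_range_iff_exists_finsupp] at h
    obtain ⟨c, hc⟩ := h
    refine sum_comaximalGenerator_mul_ne_one hz ha c.support (fun i ↦ (c i).unop) ?_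
    have := congrArg MulOpposite.unop hc
    simpa [Finsupp.sum, Finset.unop_sum] using this
  obtain ⟨m, hm, hρm⟩ := Ideal.exists_le_maximal ρ hρ
  refine ⟨(MonoidAlgebra R G)ᵐᵒᵖ ⧸ m, inferInstance, inferInstance,
    isSimpleModule_iff_isCoatom.2 hm.out, ⟨fun {s t} hst ↦ ?_⟩⟩
  by_contra hne
  -- The annihilator of the quotient, viewed as a two-sided ideal of `R[G]`.
  let I : AddSubgroup (MonoidAlgebra R G) :=
    { carrier := {x | ∀ y : (MonoidAlgebra R G)ᵐᵒᵖ, MulOpposite.op x * y ∈ m}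
      zero_mem' := fun y ↦ by simp
      add_mem' := fun {x x'} hx hx' y ↦ by
        rw [MulOpposite.op_add, add_mul]
        exact m.add_mem (hx y) (hx' y)
      neg_mem' := fun {x} hx y ↦ by
        rw [MulOpposite.op_neg, neg_mul]
        exact m.neg_mem (hx y) }
  have hIleft : ∀ x, ∀ y ∈ I, x * y ∈ I := fun x y hy w ↦ by
    rw [MulOpposite.op_mul, mul_assoc]
    exact hy _
  have hIright : ∀ x, ∀ y ∈ I, y * x ∈ I := fun x y hy w ↦ by
    rw [MulOpposite.op_mul, mul_assoc]
    exact m.mul_mem_left _ (hy _)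
  have hst' : (s - t).unop ∈ I := fun y ↦ by
    have h := hst (Submodule.Quotient.mk y : (MonoidAlgebra R G)ᵐᵒᵖ ⧸ m)
    rw [← Submodule.Quotient.mk_smul, ← Submodule.Quotient.mk_smul, Submodule.Quotient.eq] at h
    rwa [MulOpposite.op_unop, sub_mul]
  obtain ⟨i, hi⟩ := hI I (fun h ↦ hne (by
    rw [h, AddSubgroup.mem_bot] at hst'
    exact sub_eq_zero.1 (MulOpposite.unop_injective hst'))) hIleft hIright
  have hmem : ∀ x ∈ I, MulOpposite.op x ∈ m := fun x hx ↦ by simpa using hx 1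
  have hgen : MulOpposite.op (comaximalGenerator δ z a i) ∈ m :=
    hρm (Ideal.subset_span ⟨i, rfl⟩)
  have hunit : MulOpposite.op (single (z (i, none)) (1 : R)) ∈ m := by
    have h1 : MulOpposite.op (∑ p : Fin 3 × Fin 6,
        single (z (i, some p)) 1 * (δ i * single (a i p.1) 1)) ∈ m :=
      hmem _ (I.sum_mem fun p _ ↦ hIleft _ _ (hIright _ _ hi))
    have h2 := m.sub_mem hgen h1
    rwa [comaximalGenerator, MulOpposite.op_add, add_sub_cancel_right] at h2
  refine hm.ne_top (Ideal.eq_top_of_isUnit_mem _ hunit (IsUnit.op ?_))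
  exact ⟨⟨single (z (i, none)) 1, single (z (i, none))⁻¹ 1, by simp [one_def], by simp [one_def]⟩,
    rfl⟩

/-! ### Descent of ideals to a subfield -/

/-- Inserting such an `x` between two elements of a group ring makes each coefficient of the product
a single term. -/
lemma HasAlternatingConjugates.exists_separating {G : Type*} [Group G]
    (hG : HasAlternatingConjugates G) (M : Finset G) :
    ∃ x : G, ∀ f ∈ M, ∀ f' ∈ M, ∀ g ∈ M, ∀ g' ∈ M, f * x * g = f' * x * g' → f = f' ∧ g = g' := by
  classical
  let D : Finset G := ((M ×ˢ M).image (fun f ↦ f.1⁻¹ * f.2) ∪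
    (M ×ˢ M).image (fun f ↦ f.1 * f.2⁻¹)).erase 1
  obtain ⟨x, hx⟩ := hG D fun g hg ↦ (Finset.mem_erase.1 hg).1
  -- A coincidence rewrites as a trivial product of a conjugate of `f'⁻¹ f` by `x 1` and one of `g
  -- g'⁻¹` by `x 0`.
  refine ⟨(x 1)⁻¹ * x 0, fun f hf f' hf' g hg g' hg' h ↦ ?_⟩
  by_cases hff : f = f'
  · exact ⟨hff, by simpa [hff] using h⟩
  by_cases hgg : g = g'
  · exact ⟨by simpa [hgg] using h, hgg⟩
  exfalso
  have h1 : f'⁻¹ * f ∈ D := Finset.mem_erase.2 ⟨fun h ↦ hff (inv_mul_eq_one.1 h).symm,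
    Finset.mem_union_left _ (Finset.mem_image.2 ⟨(f', f), by simp [hf, hf'], rfl⟩)⟩
  have h2 : g * g'⁻¹ ∈ D := Finset.mem_erase.2 ⟨fun h ↦ hgg (mul_inv_eq_one.1 h),
    Finset.mem_union_right _ (Finset.mem_image.2 ⟨(g, g'), by simp [hg, hg'], rfl⟩)⟩
  let k : ℕ → Fin 3 := fun n ↦ if Even n then 0 else 1
  let u : ℕ → G := fun n ↦ if Even n then g * g'⁻¹ else f'⁻¹ * f
  obtain ⟨h', h0, hsucc⟩ : ∃ h' : ℕ → G, h' 0 = 1 ∧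
      ∀ n, h' (n + 1) = x (k n) * u n * (x (k n))⁻¹ * h' n :=
    ⟨fun n ↦ Nat.rec 1 (fun n h ↦ x (k n) * u n * (x (k n))⁻¹ * h) n, rfl, fun _ ↦ rfl⟩
  refine hx k u h' (fun n ↦ ?_) (fun n ↦ ?_) hsucc 1 ?_
  · by_cases hn : Even n <;> simp [u, hn, h1, h2]
  · by_cases hn : Even n <;> simp [k, Nat.even_add_one, hn]
  · have e1 : h' (1 + 1) = x 1 * (f'⁻¹ * f) * (x 1)⁻¹ * (x 0 * (g * g'⁻¹) * (x 0)⁻¹ * 1) := by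
      rw [hsucc, ← zero_add 1, hsucc, h0]
      simp [k, u]
    have e2 : x 1 * (f'⁻¹ * f) * (x 1)⁻¹ * (x 0 * (g * g'⁻¹) * (x 0)⁻¹ * 1) =
        x 1 * f'⁻¹ * (f * ((x 1)⁻¹ * x 0) * g) * g'⁻¹ * (x 0)⁻¹ := by group
    rw [e1, e2, h, h0]
    group

namespace MonoidAlgebra

open Finset

variable {k K G : Type*} [Field k] [Field K] [Algebra k K] [Group G]

/-- A nonzero ideal of `K[G]` contains a nonzero element with coefficients in a given subfield. -/
lemma exists_mapRingHom_mem (hG : HasAlternatingConjugates G) (I : AddSubgroup (MonoidAlgebra K G))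
    (hl : ∀ x, ∀ y ∈ I, x * y ∈ I) (hr : ∀ x, ∀ y ∈ I, y * x ∈ I) (α : MonoidAlgebra K G)
    (hαI : α ∈ I) (hα : α ≠ 0) :
    ∃ δ : MonoidAlgebra k G, δ ≠ 0 ∧ mapRingHom G (algebraMap k K) δ ∈ I := by
  classical
  -- Induction on the dimension over `k` of the span of the coefficients.
  induction hn : Module.finrank k (Submodule.span k (Set.range α.coeff)) using
    Nat.strong_induction_on generalizing α with
  | _ n ih =>
  let W (x : MonoidAlgebra K G) : Submodule k K := Submodule.span k (Set.range x.coeff)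
  have hW : ∀ x : MonoidAlgebra K G, ∀ g, x.coeff g ∈ W x :=
    fun x g ↦ Submodule.subset_span ⟨g, rfl⟩
  obtain ⟨f₀, hf₀⟩ : α.coeff.support.Nonempty :=
    Finsupp.support_nonempty_iff.2 (by simpa using hα)
  have hf₀' : α.coeff f₀ ≠ 0 := Finsupp.mem_support_iff.1 hf₀
  obtain ⟨l, hl0⟩ := Module.Projective.exists_dual_ne_zero k hf₀'
  let δ : MonoidAlgebra k G := .ofCoeff (α.coeff.mapRange l (map_zero l))
  have hδ : ∀ g, δ.coeff g = l (α.coeff g) := fun g ↦ rfl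
  let δK : MonoidAlgebra K G := mapRingHom G (algebraMap k K) δ
  have hδK : ∀ g, δK.coeff g = algebraMap k K (l (α.coeff g)) := fun g ↦ by
    simp [δK, hδ]
  have hδ0 : δ ≠ 0 := fun h ↦ hl0 (by rw [← hδ, h]; rfl)
  have hsupp : ∀ g, δK.coeff g ≠ 0 → g ∈ α.coeff.support := fun g hg ↦ by
    refine Finsupp.mem_support_iff.2 fun h ↦ hg ?_
    rw [hδK, h, map_zero, map_zero]
  obtain ⟨x, hx⟩ := hG.exists_separating α.coeff.support
  -- Applying `l` to the coefficients turns `α` into `δ`, hence `β` into `δxδ - δxδ = 0`. So the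
  -- coefficients of `β` lie in the part of the span killed by `l`, which misses `α.coeff f₀`.
  let β := α * (single x 1 * δK) - δK * single x 1 * α
  have hβI : β ∈ I := I.sub_mem (hr _ _ hαI) (hl _ _ hαI)
  have hleft : ∀ (y : MonoidAlgebra k G) (z : MonoidAlgebra K G) (g : G),
      (mapRingHom G (algebraMap k K) y * z).coeff g =
        ∑ h ∈ y.coeff.support, y.coeff h • z.coeff (h⁻¹ * g) := by
    intro y z g
    rw [coeff_mul_apply_left, Finsupp.sum_of_support_subset (s := y.coeff.support)]
    · simp [Algebra.smul_def]
    · intro h hh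
      simp at hh ⊢
      exact hh
    · simp
  have hright : ∀ (y : MonoidAlgebra k G) (z : MonoidAlgebra K G) (g : G),
      (z * mapRingHom G (algebraMap k K) y).coeff g =
        ∑ h ∈ y.coeff.support, y.coeff h • z.coeff (g * h⁻¹) := by
    intro y z g
    rw [coeff_mul_apply_right, Finsupp.sum_of_support_subset (s := y.coeff.support)]
    · simp [Algebra.smul_def, mul_comm]
    · intro h hh
      simp at hh ⊢
      exact hh
    · simp
  have hone : mapRingHom G (algebraMap k K) (single x 1) = single x 1 := by simp
  have hβ : β = α * mapRingHom G (algebraMap k K) (single x 1 * δ) -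
      mapRingHom G (algebraMap k K) (δ * single x 1) * α := by
    simp only [map_mul, hone, β, δK]
  have hβW : ∀ g, β.coeff g ∈ W α ⊓ LinearMap.ker l := by
    intro g
    have hcoeff : β.coeff g = ∑ h ∈ (single x 1 * δ).coeff.support,
          (single x 1 * δ).coeff h • α.coeff (g * h⁻¹) -
        ∑ h ∈ (δ * single x 1).coeff.support, (δ * single x 1).coeff h • α.coeff (h⁻¹ * g) := by
      rw [← hright, ← hleft, hβ]
      rfl
    rw [hcoeff]
    refine ⟨Submodule.sub_mem _ (Submodule.sum_mem _ fun h _ ↦ Submodule.smul_mem _ _ (hW _ _))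
      (Submodule.sum_mem _ fun h _ ↦ Submodule.smul_mem _ _ (hW _ _)), ?_⟩
    change l _ = 0
    rw [map_sub, map_sum, map_sum, sub_eq_zero]
    simp only [map_smul, ← hδ, smul_eq_mul]
    trans (δ * (single x 1 * δ)).coeff g
    · rw [coeff_mul_apply_right, Finsupp.sum]
      exact sum_congr rfl fun _ _ ↦ mul_comm _ _
    · rw [← mul_assoc, coeff_mul_apply_left, Finsupp.sum]
  by_cases hβ0 : β = 0
  -- If `β` vanishes, comparing coefficients at `f₀ x g` shows that `δ` is proportional to `α`, so
  -- it lies in the ideal.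
  · have hM : ∀ g ∈ α.coeff.support, α.coeff f₀ * δK.coeff g = δK.coeff f₀ * α.coeff g := by
      intro g hg
      have h1 := coeff_mul_of_unique α (single x 1 * δK) (f := f₀) (h := x * g) hf₀ (by
        intro f' hf' h' hh' heq
        have := hsupp (x⁻¹ * h') (by simpa using hh')
        exact ((hx f' hf' f₀ hf₀ _ this g hg) (by rw [← mul_assoc] at heq; rw [← heq]; group)).1)
      have h2 := coeff_mul_of_unique δK (single x 1 * α) (f := f₀) (h := x * g)
        (by simpa [hδK] using hl0) (by
        intro f' hf' h' hh' heq
        have h3 : x⁻¹ * h' ∈ α.coeff.support := by simpa using hh'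
        have h4 := hsupp f' (Finsupp.mem_support_iff.1 hf')
        exact ((hx f' h4 f₀ hf₀ _ h3 g hg) (by rw [← mul_assoc] at heq; rw [← heq]; group)).1)
      rw [coeff_single_mul_mul, one_mul] at h1 h2
      rw [← h1, ← h2, ← mul_assoc δK, sub_eq_zero.1 hβ0]
    refine ⟨δ, hδ0, ?_⟩
    have : δK = single 1 ((α.coeff f₀)⁻¹ * δK.coeff f₀) * α := by
      ext g
      rw [coeff_single_mul_apply, inv_one, one_mul]
      by_cases hg : g ∈ α.coeff.support
      · rw [mul_assoc, ← hM g hg, inv_mul_cancel_left₀ hf₀']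
      · rw [Finsupp.notMem_support_iff.1 hg, mul_zero]
        by_contra h
        exact hg (hsupp g h)
    change δK ∈ I
    rw [this]
    exact hl _ _ hαI
  · refine ih _ ?_ β hβI hβ0 rfl
    have : FiniteDimensional k (W α) :=
      FiniteDimensional.span_of_finite k (Finsupp.finite_range α.coeff)
    rw [← hn]
    refine Submodule.finrank_lt_finrank_of_lt (lt_of_le_of_ne ?_ fun h ↦ ?_)
    · rw [Submodule.span_le]
      rintro _ ⟨g, rfl⟩
      exact (hβW g).1
    · have h1 : W β ≤ LinearMap.ker l := by
        rw [Submodule.span_le]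
        rintro _ ⟨g, rfl⟩
        exact (hβW g).2
      have h2 : α.coeff f₀ ∈ W β := by
        rw [show W β = W α from h]
        exact hW α f₀
      exact hl0 (h1 h2)

/-! ### Cardinalities and conclusion -/

lemma lift_mk_le {R : Type v} {G : Type u} [Semiring R] [Infinite G]
    (h : Cardinal.lift.{u} (Cardinal.mk R) ≤ Cardinal.lift.{v} (Cardinal.mk G)) :
    Cardinal.mk (MonoidAlgebra R G) ≤ Cardinal.lift.{v} (Cardinal.mk G) := by
  rw [Cardinal.mk_congr coeffEquiv]
  rcases subsingleton_or_nontrivial R with hR | hR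
  · exact (Cardinal.le_one_iff_subsingleton.2 inferInstance).trans
      (Cardinal.one_le_aleph0.trans (Cardinal.aleph0_le_lift.2 (Cardinal.aleph0_le_mk G)))
  · rw [Cardinal.mk_finsupp_lift_of_infinite]
    exact max_le le_rfl h

end MonoidAlgebra

lemma AlternatingFree.exists_of_card_le {G X : Type u} [Group G] {z : X → G}
    (hz : AlternatingFree z) [Infinite X] {ι : Type w}
    (hι : Cardinal.lift.{u} (Cardinal.mk ι) ≤ Cardinal.lift.{w} (Cardinal.mk X))
    (P : Type) [Finite P] : ∃ z' : ι × P → G, AlternatingFree z' := by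
  obtain ⟨f⟩ : Nonempty (ι × P ↪ X) := by
    rw [← Cardinal.lift_mk_le', Cardinal.mk_prod]
    have hX : Cardinal.aleph0 ≤ Cardinal.lift.{w} (Cardinal.mk X) :=
      Cardinal.aleph0_le_lift.2 (Cardinal.aleph0_le_mk X)
    have hP : Cardinal.lift.{max u w} (Cardinal.mk P) ≤ Cardinal.lift.{w} (Cardinal.mk X) :=
      (Cardinal.lift_lt_aleph0.2 (Cardinal.lt_aleph0_of_finite P)).le.trans hX
    simp only [Cardinal.lift_mul, Cardinal.lift_lift]
    refine (mul_le_mul' ?_ ?_).trans (Cardinal.mul_eq_self hX).le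
    · simpa using hι
    · simpa using hP
  exact ⟨z ∘ f, hz.comp f.injective⟩

theorem corollary4p6 (G : Type u) [Group G]
    (hG : IsLocallyStrictFreeProduct G)
    (hF : ∃ F : Subgroup G, IsFreeGroup F ∧ Cardinal.mk F = Cardinal.mk G) :
    (∀ (R : Type v) [Ring R] [IsDomain R],
      Cardinal.lift.{u} (Cardinal.mk R) ≤ Cardinal.lift.{v} (Cardinal.mk G) →
        IsRightPrimitive (MonoidAlgebra R G)) ∧
    (∀ (K : Type w) [Field K], IsRightPrimitive (MonoidAlgebra K G)) := by
  have hconj := hG.hasAlternatingConjugates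
  obtain ⟨X, z, hz, hX⟩ := exists_alternatingFree_card_eq hG hF
  obtain ⟨z₀, hz₀⟩ := hG.exists_alternatingFree_nat
  have hGinf : Infinite G := Infinite.of_injective z₀ hz₀.injective
  have hXinf : Infinite X := by
    rw [← Cardinal.aleph0_le_mk_iff, hX]
    exact Cardinal.aleph0_le_mk G
  refine ⟨fun R _ _ hR ↦ ?_, fun K _ ↦ ?_⟩
  · obtain ⟨z', hz'⟩ := hz.exists_of_card_le
      (ι := {δ : MonoidAlgebra R G // δ ≠ 0}) (by
        rw [hX]
        have h1 := (Cardinal.mk_subtype_le fun δ : MonoidAlgebra R G ↦ δ ≠ 0).trans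
          (MonoidAlgebra.lift_mk_le hR)
        simpa using Cardinal.lift_le.{u}.2 h1) (Option (Fin 3 × Fin 6))
    refine isRightPrimitive_of_alternatingFree hconj (fun δ ↦ δ.2) hz' fun I hI _ _ ↦ ?_
    obtain ⟨y, hy⟩ := AddSubgroup.ne_bot_iff_exists_ne_zero.1 hI
    exact ⟨⟨y, fun h ↦ hy (Subtype.ext h)⟩, y.2⟩
  -- The prime field is countable, so `k[G]` has at most |G| elements whatever the size of `K`.
  · let k : Subfield K := Subfield.closure ∅
    have hk : Cardinal.lift.{u} (Cardinal.mk k) ≤ Cardinal.lift.{w} (Cardinal.mk G) := by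
      have h1 : Cardinal.mk k ≤ Cardinal.aleph0 := by
        exact (Subfield.cardinalMk_closure_le_max (∅ : Set K)).trans (by simp)
      exact (Cardinal.lift_le_aleph0.2 h1).trans
        (Cardinal.aleph0_le_lift.2 (Cardinal.aleph0_le_mk G))
    obtain ⟨z', hz'⟩ := hz.exists_of_card_le
      (ι := {δ : MonoidAlgebra k G // δ ≠ 0}) (by
        rw [hX]
        have h1 := (Cardinal.mk_subtype_le fun δ : MonoidAlgebra k G ↦ δ ≠ 0).trans
          (MonoidAlgebra.lift_mk_le hk)
        simpa using Cardinal.lift_le.{u}.2 h1) (Option (Fin 3 × Fin 6))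
    have hinj : Function.Injective (MonoidAlgebra.mapRingHom G (algebraMap k K)) := by
      intro x y hxy
      ext g
      simpa using congrArg (fun x ↦ x.coeff g) hxy
    refine isRightPrimitive_of_alternatingFree hconj
      (δ := fun δ : {δ : MonoidAlgebra k G // δ ≠ 0} ↦
        MonoidAlgebra.mapRingHom G (algebraMap k K) δ)
      (fun δ h ↦ δ.2 (hinj (h.trans (map_zero _).symm))) hz' fun I hI hl hr ↦ ?_
    obtain ⟨y, hy⟩ := AddSubgroup.ne_bot_iff_exists_ne_zero.1 hI
    obtain ⟨δ, hδ, hδI⟩ := MonoidAlgebra.exists_mapRingHom_mem (k := k) hconj I hl hr y y.2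
      fun h ↦ hy (Subtype.ext h)
    exact ⟨⟨δ, hδ⟩, hδI⟩
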